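/- Let $\mathbb F$ be a field. A Leibniz algebra over $\mathbb F$ is an $\mathbb F$-vector space with a bilinear multiplication satisfying $x(yz)=(xy)z+y(xz)$. For a Leibniz algebra $A$ let $Z(A)=\{z : za=az=0 \text{ for all } a\in A\}$ be its center and let $A'=AA$ be the span of all products. A surjective homomorphism $\varphi:E\to L$ of Leibniz algebras is a central extension $0\to\ker\varphi\to E\xrightarrow{\varphi}L\to 0$ of $L$ if $\ker\varphi\subseteq Z(E)$. Let $Z^*(L)$ be the intersection of the images $\varphi(Z(E))$ over all central extensions of $L$. A defining pair for $L$ is a pair $(K,M)$, where $K$ is a Leibniz algebra and $M\subseteq Z(K)\cap K'$ is an ideal of $K$ with $K/M\cong L$; $K$ is a cover of $L$ if it is the first member of a defining pair for $L$ with $\dim K$ maximal among all defining pairs. A stem extension of $L$ is a central extension $0\to\ker\varphi\to E\xrightarrow{\varphi}L\to0$ in which $E$ is a cover of $L$. **Theorem.** Let $L$ be a Leibniz algebra over $\mathbb F$, let $0\to R\to F\xrightarrow{\pi}L\to0$ be any free presentation of $L$ (that is, $F$ is a free Leibniz algebra, $\pi$ is a surjective homomorphism and $R=\ker\pi$), let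 $\overline F=F/(FR+RF)$, and let $\overline\pi:\overline F\to L$ be the homomorphism induced by $\pi$. Then $$Z^*(L)=\overline\pi(Z(\overline F)).$$ If moreover $L$ is finite-dimensional, then for every stem extension $0\to\ker\varphi\to E\xrightarrow{\varphi}L\to0$ of $L$ $$Z^*(L)=\overline\pi(Z(\overline F))=\varphi(Z(E)).$$ In particular, the image of the center of any cover of $L$ is $Z^*(L)$. -/

import Mathlib

universe u v w

/-- A (left) Leibniz algebra: the multiplication satisfies `x(yz) = (xy)z + y(xz)`.
Bilinearity over the base field is carried by `NonUnitalNonAssocRing`, `IsScalarTower` and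
`SMulCommClass`. -/
class IsLeibniz (A : Type*) [NonUnitalNonAssocRing A] : Prop where
  leibniz : ∀ x y z : A, x * (y * z) = (x * y) * z + y * (x * z)

namespace Leibniz

/-- A two-sided ideal of a (not necessarily associative or unital) `𝕜`-algebra. -/
structure AlgIdeal (𝕜 : Type*) (A : Type*) [Field 𝕜] [NonUnitalNonAssocRing A] [Module 𝕜 A]
    extends Submodule 𝕜 A where
  mul_mem_left : ∀ (x : A) {y : A}, y ∈ carrier → x * y ∈ carrier
  mul_mem_right : ∀ {x : A} (y : A), x ∈ carrier → x * y ∈ carrier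

section Algebra

variable (𝕜 : Type*) [Field 𝕜]

section Subspaces

variable (A : Type*) [NonUnitalNonAssocRing A] [Module 𝕜 A] [IsScalarTower 𝕜 A A]
  [SMulCommClass 𝕜 A A]

/-- The (two-sided) center `Z(A)`: all `z` with `za = az = 0` for every `a`. -/
def center : Submodule 𝕜 A where
  carrier := {z | ∀ a : A, z * a = 0 ∧ a * z = 0}
  zero_mem' := fun a => ⟨zero_mul a, mul_zero a⟩
  add_mem' := fun {x y} hx hy a => by
    simp [add_mul, mul_add, (hx a).1, (hx a).2, (hy a).1, (hy a).2]
  smul_mem' := fun c x hx a => by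
    simp [smul_mul_assoc, mul_smul_comm, (hx a).1, (hx a).2]

/-- The derived algebra `A' = AA`, the linear span of all products. -/
def derived : Submodule 𝕜 A := Submodule.span 𝕜 {x | ∃ a b : A, x = a * b}

end Subspaces

section Quotient

variable {𝕜} {A : Type*} [NonUnitalNonAssocRing A] [Module 𝕜 A]

/-- The quotient algebra `A / I`. -/
def AlgIdeal.Quotient (I : AlgIdeal 𝕜 A) : Type _ := A ⧸ I.toSubmodule

namespace AlgIdeal

variable (I : AlgIdeal 𝕜 A)

instance : AddCommGroup I.Quotient := inferInstanceAs (AddCommGroup (A ⧸ I.toSubmodule))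

instance : Module 𝕜 I.Quotient := inferInstanceAs (Module 𝕜 (A ⧸ I.toSubmodule))

/-- The linear quotient map `A → A / I`. -/
def proj : A →ₗ[𝕜] I.Quotient := I.toSubmodule.mkQ

theorem proj_surjective : Function.Surjective I.proj := I.toSubmodule.mkQ_surjective

theorem proj_eq_iff {x y : A} : I.proj x = I.proj y ↔ x - y ∈ I.toSubmodule :=
  Submodule.Quotient.eq _

instance : Mul I.Quotient where
  mul := Quotient.map₂ (· * ·) (by
    intro a a' ha b b' hb
    have ha' : a - a' ∈ I.toSubmodule := (Submodule.quotientRel_def _).1 ha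
    have hb' : b - b' ∈ I.toSubmodule := (Submodule.quotientRel_def _).1 hb
    refine (Submodule.quotientRel_def _).2 ?_
    have h : a * b - a' * b' = a * (b - b') + (a - a') * b' := by
      rw [mul_sub, sub_mul]; abel
    rw [h]
    exact add_mem (I.mul_mem_left _ hb') (I.mul_mem_right _ ha'))

theorem proj_mul (x y : A) : I.proj (x * y) = I.proj x * I.proj y := rfl

instance : NonUnitalNonAssocRing I.Quotient :=
  { (inferInstance : AddCommGroup I.Quotient), (inferInstance : Mul I.Quotient) with
    left_distrib := by
      intro a b c
      obtain ⟨a, rfl⟩ := I.proj_surjective a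
      obtain ⟨b, rfl⟩ := I.proj_surjective b
      obtain ⟨c, rfl⟩ := I.proj_surjective c
      change I.proj a * (I.proj b + I.proj c) = I.proj a * I.proj b + I.proj a * I.proj c
      simp only [← proj_mul, ← map_add, mul_add]
    right_distrib := by
      intro a b c
      obtain ⟨a, rfl⟩ := I.proj_surjective a
      obtain ⟨b, rfl⟩ := I.proj_surjective b
      obtain ⟨c, rfl⟩ := I.proj_surjective c
      change (I.proj a + I.proj b) * I.proj c = I.proj a * I.proj c + I.proj b * I.proj c
      simp only [← proj_mul, ← map_add, add_mul]
    zero_mul := by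
      intro a
      obtain ⟨a, rfl⟩ := I.proj_surjective a
      change (0 : I.Quotient) * I.proj a = 0
      rw [← map_zero I.proj, ← proj_mul, zero_mul]
    mul_zero := by
      intro a
      obtain ⟨a, rfl⟩ := I.proj_surjective a
      change I.proj a * (0 : I.Quotient) = 0
      rw [← map_zero I.proj, ← proj_mul, mul_zero] }

instance [IsScalarTower 𝕜 A A] : IsScalarTower 𝕜 I.Quotient I.Quotient where
  smul_assoc c x y := by
    obtain ⟨x, rfl⟩ := I.proj_surjective x
    obtain ⟨y, rfl⟩ := I.proj_surjective y
    simp only [smul_eq_mul, ← map_smul, ← proj_mul, smul_mul_assoc]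

instance [SMulCommClass 𝕜 A A] : SMulCommClass 𝕜 I.Quotient I.Quotient where
  smul_comm c x y := by
    obtain ⟨x, rfl⟩ := I.proj_surjective x
    obtain ⟨y, rfl⟩ := I.proj_surjective y
    simp only [smul_eq_mul, ← map_smul, ← proj_mul, mul_smul_comm]

instance [IsLeibniz A] : IsLeibniz I.Quotient where
  leibniz x y z := by
    obtain ⟨x, rfl⟩ := I.proj_surjective x
    obtain ⟨y, rfl⟩ := I.proj_surjective y
    obtain ⟨z, rfl⟩ := I.proj_surjective z
    simp only [← map_add, ← proj_mul, IsLeibniz.leibniz x y z]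

variable (𝕜) in
/-- The smallest two-sided ideal containing a set. -/
def closure (s : Set A) : AlgIdeal 𝕜 A where
  toSubmodule := sInf {S | ∃ J : AlgIdeal 𝕜 A, J.toSubmodule = S ∧ s ⊆ (S : Set A)}
  mul_mem_left x y hy := by
    refine (Submodule.mem_sInf (x := x * y)).2 ?_
    rintro _ ⟨J, rfl, hJ⟩
    exact J.mul_mem_left x ((Submodule.mem_sInf.1 hy) _ ⟨J, rfl, hJ⟩)
  mul_mem_right {x} y hx := by
    refine (Submodule.mem_sInf (x := x * y)).2 ?_
    rintro _ ⟨J, rfl, hJ⟩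
    exact J.mul_mem_right y ((Submodule.mem_sInf.1 hx) _ ⟨J, rfl, hJ⟩)

end AlgIdeal

end Quotient

section Free

/-- The ideal of the free nonassociative algebra on `X` generated by all
`a(bc) - ((ab)c + b(ac))`. -/
noncomputable def leibnizIdeal (X : Type*) : AlgIdeal 𝕜 (FreeNonUnitalNonAssocAlgebra 𝕜 X) :=
  AlgIdeal.closure 𝕜 {t | ∃ a b c, t = a * (b * c) - ((a * b) * c + b * (a * c))}

/-- The free Leibniz algebra on the set `X`. -/
abbrev FreeLeibniz (X : Type*) : Type _ := (leibnizIdeal 𝕜 X).Quotient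

/-- `F` is a free Leibniz algebra: it is isomorphic to the free Leibniz algebra on some set. -/
def IsFreeLeibniz (F : Type w) [NonUnitalNonAssocRing F] [Module 𝕜 F] : Prop :=
  ∃ (X : Type w) (e : FreeLeibniz 𝕜 X →ₙₐ[𝕜] F), Function.Bijective e

end Free

section Extensions

variable {𝕜} {A B : Type*} [NonUnitalNonAssocRing A] [Module 𝕜 A]
  [NonUnitalNonAssocRing B] [Module 𝕜 B]

/-- The kernel of a homomorphism, as an ideal. -/
def ker (f : A →ₙₐ[𝕜] B) : AlgIdeal 𝕜 A where
  carrier := {x | f x = 0}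
  zero_mem' := map_zero f
  add_mem' := fun {x y} hx hy => by
    have h₁ : f x = 0 := hx
    have h₂ : f y = 0 := hy
    change f (x + y) = 0
    rw [map_add, h₁, h₂, add_zero]
  smul_mem' := fun c x hx => by
    have h : f x = 0 := hx
    change f (c • x) = 0
    rw [map_smul, h, smul_zero]
  mul_mem_left x y hy := by
    change f (x * y) = 0
    have h : f y = 0 := hy
    rw [map_mul, h, mul_zero]
  mul_mem_right {x} y hx := by
    change f (x * y) = 0
    have h : f x = 0 := hx
    rw [map_mul, h, zero_mul]

/-- `0 → ker f → A → B → 0` is a central extension of `B`. -/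
def IsCentralExtension [IsScalarTower 𝕜 A A] [SMulCommClass 𝕜 A A] (f : A →ₙₐ[𝕜] B) : Prop :=
  Function.Surjective f ∧ (ker f).toSubmodule ≤ center 𝕜 A

/-- The subspace `AR + RA`, where `R` is an ideal of `A`. It is an ideal, because
`AR + RA ⊆ R`. -/
def bracketIdeal (R : AlgIdeal 𝕜 A) : AlgIdeal 𝕜 A :=
  let S : Submodule 𝕜 A :=
    Submodule.span 𝕜 {x | ∃ a : A, ∃ r ∈ R.toSubmodule, x = a * r} ⊔
      Submodule.span 𝕜 {x | ∃ r ∈ R.toSubmodule, ∃ a : A, x = r * a}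
  have hS : S ≤ R.toSubmodule := by
    refine sup_le (Submodule.span_le.2 ?_) (Submodule.span_le.2 ?_)
    · rintro _ ⟨a, r, hr, rfl⟩
      exact R.mul_mem_left a hr
    · rintro _ ⟨r, hr, a, rfl⟩
      exact R.mul_mem_right a hr
  { S with
    mul_mem_left := fun x y hy =>
      (le_sup_left : _ ≤ S) (Submodule.subset_span ⟨x, y, hS hy, rfl⟩)
    mul_mem_right := fun {x} y hx =>
      (le_sup_right : _ ≤ S) (Submodule.subset_span ⟨x, hS hx, y, rfl⟩) }

theorem bracketIdeal_le (R : AlgIdeal 𝕜 A) : (bracketIdeal R).toSubmodule ≤ R.toSubmodule := by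
  refine sup_le (Submodule.span_le.2 ?_) (Submodule.span_le.2 ?_)
  · rintro _ ⟨a, r, hr, rfl⟩
    exact R.mul_mem_left a hr
  · rintro _ ⟨r, hr, a, rfl⟩
    exact R.mul_mem_right a hr

/-- For `f : A → B` with kernel `R`, the algebra `A / (AR + RA)`. -/
abbrev Bar (f : A →ₙₐ[𝕜] B) : Type _ := (bracketIdeal (ker f)).Quotient

/-- The homomorphism `A / (AR + RA) → B` induced by `f : A → B`, where `R` is the kernel
of `f`. -/
def barMap (f : A →ₙₐ[𝕜] B) : Bar f →ₙₐ[𝕜] B :=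
  let g : (A ⧸ (bracketIdeal (ker f)).toSubmodule) →ₗ[𝕜] B :=
    (bracketIdeal (ker f)).toSubmodule.liftQ (f : A →ₗ[𝕜] B)
      (fun _ hx => bracketIdeal_le (ker f) hx)
  { toFun := g
    map_smul' := fun c x => g.map_smul c x
    map_zero' := g.map_zero
    map_add' := fun x y => g.map_add x y
    map_mul' := fun x y => by
      obtain ⟨x, rfl⟩ := AlgIdeal.proj_surjective _ x
      obtain ⟨y, rfl⟩ := AlgIdeal.proj_surjective _ y
      exact map_mul f x y }

theorem barMap_proj (f : A →ₙₐ[𝕜] B) (x : A) :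
    barMap f ((bracketIdeal (ker f)).proj x) = f x := rfl

end Extensions

end Algebra

/-- `Z*(L)`: the intersection of the images `φ(Z(E))` over all central extensions
`0 → ker φ → E → L → 0` of `L` by Leibniz algebras. -/
def zStar (𝕜 : Type v) [Field 𝕜] (L : Type u) [NonUnitalNonAssocRing L] [Module 𝕜 L] :
    Set L :=
  {x | ∀ (E : Type (max u v)) [NonUnitalNonAssocRing E] [Module 𝕜 E] [IsScalarTower 𝕜 E E]
    [SMulCommClass 𝕜 E E] [IsLeibniz E] (φ : E →ₙₐ[𝕜] L),
    IsCentralExtension φ → x ∈ φ '' (center 𝕜 E : Set E)}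

/-- `(K, M)` is a defining pair for `L`: `L ≅ K / M` and `M ⊆ Z(K) ∩ K'`. -/
def IsDefiningPair (𝕜 : Type*) [Field 𝕜] (L : Type*) [NonUnitalNonAssocRing L] [Module 𝕜 L]
    (K : Type*) [NonUnitalNonAssocRing K] [Module 𝕜 K] [IsScalarTower 𝕜 K K]
    [SMulCommClass 𝕜 K K] (M : AlgIdeal 𝕜 K) : Prop :=
  (∃ e : M.Quotient →ₙₐ[𝕜] L, Function.Bijective e) ∧
    M.toSubmodule ≤ center 𝕜 K ⊓ derived 𝕜 K

/-- `K` is a cover of `L`: it is the first member of a defining pair for `L` for which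
the dimension of the first member is maximal. -/
def IsCover (𝕜 : Type v) [Field 𝕜] (L : Type u) [NonUnitalNonAssocRing L] [Module 𝕜 L]
    (K : Type (max u v)) [NonUnitalNonAssocRing K] [Module 𝕜 K] [IsScalarTower 𝕜 K K]
    [SMulCommClass 𝕜 K K] : Prop :=
  (∃ M : AlgIdeal 𝕜 K, IsDefiningPair 𝕜 L K M) ∧
    ∀ (J : Type (max u v)) [NonUnitalNonAssocRing J] [Module 𝕜 J] [IsScalarTower 𝕜 J J]
      [SMulCommClass 𝕜 J J] [IsLeibniz J] (N : AlgIdeal 𝕜 J),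
      IsDefiningPair 𝕜 L J N → Module.rank 𝕜 J ≤ Module.rank 𝕜 K

/-- `0 → ker φ → E → L → 0` is a stem extension of `L`: a central extension in which `E` is a
cover of `L`. (When `L` is finite-dimensional, a comparison of the dimensions of `E / E'` and
`L / L'` shows that `ker φ ⊆ E'` holds automatically, so it is not required here.) -/
def IsStemExtension {𝕜 : Type v} [Field 𝕜] {L : Type u} [NonUnitalNonAssocRing L] [Module 𝕜 L]
    {E : Type (max u v)} [NonUnitalNonAssocRing E] [Module 𝕜 E] [IsScalarTower 𝕜 E E]
    [SMulCommClass 𝕜 E E] (φ : E →ₙₐ[𝕜] L) : Prop :=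
  IsCentralExtension φ ∧ IsCover 𝕜 L E

end Leibniz

/-! In a central extension of `L` a product depends only on the images of its factors in `L`
(`IsCentralExtension.mul_eq_mul`). The algebra `Bar π` is itself a central extension, and since free
algebras are projective it maps over `L` to every other one (`IsFreeLeibniz.exists_bar_lift`). Such
a map sends central elements to central elements, so the image of the center of `Bar π` is the
smallest possible one and equals `Z*(L)`. For a stem extension `φ` of a finite-dimensional `L`, the
reverse inclusion is needed. Let `P` be a central extension with a map `η` to `E` over `L`; then `η`
is onto. Maximality of `dim E` forces `η` to be injective on the part of the kernel of `P → L`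
inside `P'` (`eq_zero_of_mem_derived`). If `η p` is central, then `p * a` and `a * p` lie in `P'`
and are killed by `η`, so they vanish and `p` is central. Taking `P = Bar π₀` finishes the proof. -/

namespace Leibniz

/-! ### Homomorphisms and quotients. -/

section Homomorphisms

variable {𝕜 : Type*} [Field 𝕜] {A B : Type*} [NonUnitalNonAssocRing A] [Module 𝕜 A]
  [NonUnitalNonAssocRing B] [Module 𝕜 B]

theorem mem_ker {f : A →ₙₐ[𝕜] B} {x : A} : x ∈ (ker f).toSubmodule ↔ f x = 0 := Iff.rfl

namespace AlgIdeal

theorem proj_eq_zero_iff (I : AlgIdeal 𝕜 A) {x : A} : I.proj x = 0 ↔ x ∈ I.toSubmodule :=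
  Submodule.Quotient.mk_eq_zero _

/-- The quotient map as an algebra homomorphism. -/
def projHom (I : AlgIdeal 𝕜 A) : A →ₙₐ[𝕜] I.Quotient :=
  { I.proj with
    map_zero' := I.proj.map_zero
    map_mul' := I.proj_mul }

@[simp]
theorem projHom_apply (I : AlgIdeal 𝕜 A) (x : A) : I.projHom x = I.proj x := rfl

/-- The homomorphism out of a quotient algebra induced by one that kills the ideal. -/
def lift (I : AlgIdeal 𝕜 A) (f : A →ₙₐ[𝕜] B) (h : I.toSubmodule ≤ (ker f).toSubmodule) :
    I.Quotient →ₙₐ[𝕜] B :=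
  let g : (A ⧸ I.toSubmodule) →ₗ[𝕜] B := I.toSubmodule.liftQ (f : A →ₗ[𝕜] B) h
  { toFun := g
    map_smul' := fun c x => g.map_smul c x
    map_zero' := g.map_zero
    map_add' := fun x y => g.map_add x y
    map_mul' := fun x y => by
      obtain ⟨x, rfl⟩ := I.proj_surjective x
      obtain ⟨y, rfl⟩ := I.proj_surjective y
      exact map_mul f x y }

@[simp]
theorem lift_proj (I : AlgIdeal 𝕜 A) (f : A →ₙₐ[𝕜] B)
    (h : I.toSubmodule ≤ (ker f).toSubmodule) (x : A) : I.lift f h (I.proj x) = f x := rfl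

theorem closure_le {s : Set A} {J : AlgIdeal 𝕜 A} (h : s ⊆ (J.toSubmodule : Set A)) :
    (closure 𝕜 s).toSubmodule ≤ J.toSubmodule :=
  sInf_le ⟨J, rfl, h⟩

/-- A subspace of the center is an ideal. -/
def ofLeCenter [IsScalarTower 𝕜 A A] [SMulCommClass 𝕜 A A] (S : Submodule 𝕜 A)
    (hS : S ≤ center 𝕜 A) : AlgIdeal 𝕜 A :=
  { S with
    mul_mem_left := fun x y hy => by
      rw [(hS hy x).2]
      exact S.zero_mem
    mul_mem_right := fun {x} y hx => by
      rw [(hS hx y).1]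
      exact S.zero_mem }

end AlgIdeal

theorem isLeibniz_of_surjective [IsLeibniz A] (f : A →ₙₐ[𝕜] B) (hf : Function.Surjective f) :
    IsLeibniz B where
  leibniz x y z := by
    obtain ⟨x, rfl⟩ := hf x
    obtain ⟨y, rfl⟩ := hf y
    obtain ⟨z, rfl⟩ := hf z
    simp only [← map_mul, ← map_add, ← IsLeibniz.leibniz x y z]

theorem mul_mem_derived (a b : A) : a * b ∈ derived 𝕜 A := Submodule.subset_span ⟨a, b, rfl⟩

theorem map_derived {f : A →ₙₐ[𝕜] B} (hf : Function.Surjective f) :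
    (derived 𝕜 A).map (f : A →ₗ[𝕜] B) = derived 𝕜 B := by
  rw [derived, derived, Submodule.map_span]
  congr 1
  ext x
  constructor
  · rintro ⟨_, ⟨a, b, rfl⟩, rfl⟩
    exact ⟨f a, f b, map_mul f a b⟩
  · rintro ⟨a, b, rfl⟩
    obtain ⟨a, rfl⟩ := hf a
    obtain ⟨b, rfl⟩ := hf b
    exact ⟨a * b, ⟨a, b, rfl⟩, map_mul f a b⟩

end Homomorphisms

/-! ### Free Leibniz algebras and projectivity. -/

section FreeAlgebras

variable {𝕜 : Type*} [Field 𝕜] {X : Type*}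

instance : IsLeibniz (FreeLeibniz 𝕜 X) where
  leibniz x y z := by
    obtain ⟨x, rfl⟩ := AlgIdeal.proj_surjective _ x
    obtain ⟨y, rfl⟩ := AlgIdeal.proj_surjective _ y
    obtain ⟨z, rfl⟩ := AlgIdeal.proj_surjective _ z
    rw [← AlgIdeal.proj_mul, ← AlgIdeal.proj_mul, ← AlgIdeal.proj_mul, ← AlgIdeal.proj_mul,
      ← AlgIdeal.proj_mul, ← AlgIdeal.proj_mul, ← map_add, AlgIdeal.proj_eq_iff]
    refine Submodule.mem_sInf.2 ?_
    rintro _ ⟨J, rfl, hJ⟩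
    exact hJ ⟨x, y, z, rfl⟩

theorem IsFreeLeibniz.isLeibniz {F : Type*} [NonUnitalNonAssocRing F] [Module 𝕜 F]
    (hF : IsFreeLeibniz 𝕜 F) : IsLeibniz F := by
  obtain ⟨X, e, he⟩ := hF
  exact isLeibniz_of_surjective e he.2

variable {A : Type*} [NonUnitalNonAssocRing A] [Module 𝕜 A] [IsScalarTower 𝕜 A A]
  [SMulCommClass 𝕜 A A]

/-- The universal property of the free Leibniz algebra. -/
noncomputable def FreeLeibniz.lift [IsLeibniz A] (f : X → A) : FreeLeibniz 𝕜 X →ₙₐ[𝕜] A :=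
  (leibnizIdeal 𝕜 X).lift (FreeNonUnitalNonAssocAlgebra.lift 𝕜 f) <|
    AlgIdeal.closure_le <| by
      rintro _ ⟨a, b, c, rfl⟩
      change FreeNonUnitalNonAssocAlgebra.lift 𝕜 f _ = 0
      rw [map_sub, map_add]
      simp only [map_mul]
      rw [IsLeibniz.leibniz, sub_self]

/-- The canonical generators of the free Leibniz algebra. -/
noncomputable def FreeLeibniz.of (x : X) : FreeLeibniz 𝕜 X :=
  (leibnizIdeal 𝕜 X).proj (FreeNonUnitalNonAssocAlgebra.of 𝕜 x)

@[simp]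
theorem FreeLeibniz.lift_of [IsLeibniz A] (f : X → A) (x : X) :
    FreeLeibniz.lift f (FreeLeibniz.of (𝕜 := 𝕜) x) = f x :=
  FreeNonUnitalNonAssocAlgebra.lift_of_apply 𝕜 f x

theorem FreeLeibniz.hom_ext {f g : FreeLeibniz 𝕜 X →ₙₐ[𝕜] A}
    (h : ∀ x, f (FreeLeibniz.of x) = g (FreeLeibniz.of x)) : f = g := by
  have key : f.comp (leibnizIdeal 𝕜 X).projHom = g.comp (leibnizIdeal 𝕜 X).projHom :=
    FreeNonUnitalNonAssocAlgebra.hom_ext 𝕜 h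
  ext x
  obtain ⟨x, rfl⟩ := AlgIdeal.proj_surjective _ x
  exact DFunLike.congr_fun key x

/-- The `ULift` places the algebra in `Type (max u v)`, the universe over which `zStar` quantifies.
-/
theorem FreeLeibniz.isFreeLeibniz (𝕜 : Type v) [Field 𝕜] (L : Type u) :
    IsFreeLeibniz 𝕜 (FreeLeibniz 𝕜 (ULift.{v} L)) :=
  ⟨ULift.{v} L, NonUnitalAlgHom.id 𝕜 _, Function.bijective_id⟩

/-- Free Leibniz algebras are projective. -/
theorem IsFreeLeibniz.exists_lift {F : Type*} [NonUnitalNonAssocRing F] [Module 𝕜 F]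
    (hF : IsFreeLeibniz 𝕜 F) {B : Type*} [NonUnitalNonAssocRing B] [Module 𝕜 B]
    [IsScalarTower 𝕜 B B] [SMulCommClass 𝕜 B B] [IsLeibniz A]
    (φ : A →ₙₐ[𝕜] B) (hφ : Function.Surjective φ) (π : F →ₙₐ[𝕜] B) :
    ∃ h : F →ₙₐ[𝕜] A, ∀ x, φ (h x) = π x := by
  obtain ⟨X, e, he⟩ := hF
  obtain ⟨i, hi₁, hi₂⟩ := Function.bijective_iff_has_inverse.1 he
  choose s hs using hφ
  let g : FreeLeibniz 𝕜 X →ₙₐ[𝕜] A := FreeLeibniz.lift fun x => s (π (e (FreeLeibniz.of x)))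
  have hg : φ.comp g = π.comp e := FreeLeibniz.hom_ext fun x => by
    simp [g, hs]
  refine ⟨g.comp (NonUnitalAlgHom.inverse e i hi₁ hi₂), fun x => ?_⟩
  have := DFunLike.congr_fun hg (i x)
  simp only [NonUnitalAlgHom.comp_apply, hi₂ x] at this
  exact this

end FreeAlgebras

/-! ### Central extensions and the weak universality of `Bar π`. -/

section CentralExtensions

variable {𝕜 : Type*} [Field 𝕜] {F E L : Type*}
  [NonUnitalNonAssocRing F] [Module 𝕜 F]
  [NonUnitalNonAssocRing E] [Module 𝕜 E] [IsScalarTower 𝕜 E E] [SMulCommClass 𝕜 E E]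
  [NonUnitalNonAssocRing L] [Module 𝕜 L]

theorem IsCentralExtension.mul_eq_zero {φ : E →ₙₐ[𝕜] L} (hφ : IsCentralExtension φ) {x : E}
    (hx : φ x = 0) (a : E) : x * a = 0 ∧ a * x = 0 :=
  hφ.2 hx a

/-- Changing a factor by an element of the central kernel does not change the product. -/
theorem IsCentralExtension.mul_eq_mul {φ : E →ₙₐ[𝕜] L} (hφ : IsCentralExtension φ)
    {a b c d : E} (h : φ a = φ c) (h' : φ b = φ d) : a * b = c * d := by
  have h₁ := (hφ.mul_eq_zero (x := a - c) (by rw [map_sub, h, sub_self]) b).1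
  have h₂ := (hφ.mul_eq_zero (x := b - d) (by rw [map_sub, h', sub_self]) c).2
  rw [sub_mul, sub_eq_zero] at h₁
  rw [mul_sub, sub_eq_zero] at h₂
  rw [h₁, h₂]

theorem barMap_surjective {π : F →ₙₐ[𝕜] L} (hπ : Function.Surjective π) :
    Function.Surjective (barMap π) := fun x => by
  obtain ⟨y, rfl⟩ := hπ x
  exact ⟨_, barMap_proj π y⟩

theorem isCentralExtension_barMap [IsScalarTower 𝕜 F F] [SMulCommClass 𝕜 F F]
    {π : F →ₙₐ[𝕜] L} (hπ : Function.Surjective π) : IsCentralExtension (barMap π) := by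
  refine ⟨barMap_surjective hπ, fun x hx a => ?_⟩
  obtain ⟨x, rfl⟩ := AlgIdeal.proj_surjective _ x
  obtain ⟨a, rfl⟩ := AlgIdeal.proj_surjective _ a
  have hx' : x ∈ (ker π).toSubmodule := hx
  rw [← AlgIdeal.proj_mul, ← AlgIdeal.proj_mul, AlgIdeal.proj_eq_zero_iff,
    AlgIdeal.proj_eq_zero_iff]
  exact ⟨Submodule.mem_sup_right (Submodule.subset_span ⟨x, hx', a, rfl⟩),
    Submodule.mem_sup_left (Submodule.subset_span ⟨a, x, hx', rfl⟩)⟩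

/-- A free presentation, made central, maps to every central extension. -/
theorem IsFreeLeibniz.exists_bar_lift (hF : IsFreeLeibniz 𝕜 F) [IsScalarTower 𝕜 L L]
    [SMulCommClass 𝕜 L L] [IsLeibniz E] {φ : E →ₙₐ[𝕜] L} (hφ : IsCentralExtension φ)
    (π : F →ₙₐ[𝕜] L) : ∃ h : Bar π →ₙₐ[𝕜] E, ∀ x, φ (h x) = barMap π x := by
  obtain ⟨h, hh⟩ := hF.exists_lift φ hφ.1 π
  refine ⟨(bracketIdeal (ker π)).lift h ?_, fun x => ?_⟩
  -- The lift sends `R` into the central kernel of `φ`, so it kills `FR + RF`.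
  · have h0 : ∀ r ∈ (ker π).toSubmodule, φ (h r) = 0 := fun r hr => (hh r).trans hr
    refine sup_le (Submodule.span_le.2 ?_) (Submodule.span_le.2 ?_)
    · rintro _ ⟨a, r, hr, rfl⟩
      exact (map_mul h a r).trans (hφ.mul_eq_zero (h0 r hr) _).2
    · rintro _ ⟨r, hr, a, rfl⟩
      exact (map_mul h r a).trans (hφ.mul_eq_zero (h0 r hr) _).1
  · obtain ⟨x, rfl⟩ := AlgIdeal.proj_surjective _ x
    exact hh x

theorem IsFreeLeibniz.image_center_subset (hF : IsFreeLeibniz 𝕜 F) [IsScalarTower 𝕜 F F]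
    [SMulCommClass 𝕜 F F] [IsScalarTower 𝕜 L L]
    [SMulCommClass 𝕜 L L] [IsLeibniz E] {φ : E →ₙₐ[𝕜] L} (hφ : IsCentralExtension φ)
    {π : F →ₙₐ[𝕜] L} (hπ : Function.Surjective π) :
    barMap π '' (center 𝕜 (Bar π) : Set (Bar π)) ⊆ φ '' (center 𝕜 E : Set E) := by
  obtain ⟨h, hh⟩ := hF.exists_bar_lift hφ π
  rintro _ ⟨z, hz, rfl⟩
  refine ⟨h z, fun a => ?_, hh z⟩
  -- `h` need not be onto, but multiplication by `a` agrees with multiplication by `h b` once both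
  -- lie over the same element of `L`.
  obtain ⟨b, hb⟩ := barMap_surjective hπ (φ a)
  have hab : φ a = φ (h b) := by rw [hh, hb]
  rw [hφ.mul_eq_mul rfl hab, hφ.mul_eq_mul hab rfl, ← map_mul, ← map_mul, (hz b).1, (hz b).2,
    map_zero]
  exact ⟨rfl, rfl⟩

/-- The derived algebra of a central extension of a finite-dimensional algebra is
finite-dimensional. -/
theorem IsCentralExtension.finiteDimensional_derived [FiniteDimensional 𝕜 L]
    {φ : E →ₙₐ[𝕜] L} (hφ : IsCentralExtension φ) : FiniteDimensional 𝕜 (derived 𝕜 E) := by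
  -- Each factor may be replaced by its value under a linear section, so products of elements of the
  -- finite-dimensional space `range s` already span `E'`.
  obtain ⟨s, hs⟩ := (φ : E →ₗ[𝕜] L).exists_rightInverse_of_surjective
    (LinearMap.range_eq_top.2 hφ.1)
  have hs' : ∀ x, φ (s x) = x := fun x => LinearMap.congr_fun hs x
  have hW : (LinearMap.range s).FG := Module.Finite.iff_fg.1 inferInstance
  have hfg := hW.map₂ (LinearMap.mul 𝕜 E) hW
  have : FiniteDimensional 𝕜
      (Submodule.map₂ (LinearMap.mul 𝕜 E) (LinearMap.range s) (LinearMap.range s)) :=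
    Module.Finite.iff_fg.2 hfg
  refine Submodule.finiteDimensional_of_le (S₂ := Submodule.map₂ (LinearMap.mul 𝕜 E)
    (LinearMap.range s) (LinearMap.range s)) (Submodule.span_le.2 ?_)
  rintro _ ⟨a, b, rfl⟩
  rw [hφ.mul_eq_mul (hs' (φ a)).symm (hs' (φ b)).symm]
  exact Submodule.apply_mem_map₂ (LinearMap.mul 𝕜 E) ⟨_, rfl⟩ ⟨_, rfl⟩

theorem IsCentralExtension.finiteDimensional [FiniteDimensional 𝕜 L]
    {φ : E →ₙₐ[𝕜] L} (hφ : IsCentralExtension φ)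
    (h : (ker φ).toSubmodule ≤ derived 𝕜 E) : FiniteDimensional 𝕜 E := by
  have := hφ.finiteDimensional_derived
  have hker : FiniteDimensional 𝕜 (LinearMap.ker (φ : E →ₗ[𝕜] L)) :=
    Submodule.finiteDimensional_of_le h
  have hquot : FiniteDimensional 𝕜 (E ⧸ LinearMap.ker (φ : E →ₗ[𝕜] L)) :=
    ((φ : E →ₗ[𝕜] L).quotKerEquivOfSurjective hφ.1).symm.finiteDimensional
  exact Module.Finite.of_submodule_quotient (LinearMap.ker (φ : E →ₗ[𝕜] L))

end CentralExtensions

/-! ### A dimension count. -/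

section LinearAlgebra

variable {𝕜 : Type*} [Field 𝕜] {V W : Type*} [AddCommGroup V] [Module 𝕜 V] [AddCommGroup W]
  [Module 𝕜 W]

/-- Rank-nullity for `V → W / k(D)`, whose kernel is `D ⊔ ker k`, shows that `dim (D ⊔ ker k)`
depends only on `k(D)`. Hence `D` absorbs both kernels or neither. -/
theorem ker_le_of_map_eq [FiniteDimensional 𝕜 V] {f g : V →ₗ[𝕜] W}
    (hf : Function.Surjective f) (hg : Function.Surjective g) {D : Submodule 𝕜 V}
    (hD : D.map f = D.map g) (h : LinearMap.ker f ≤ D) : LinearMap.ker g ≤ D := by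
  have hdim : ∀ k : V →ₗ[𝕜] W, Function.Surjective k →
      Module.finrank 𝕜 (W ⧸ D.map k) + Module.finrank 𝕜 ↥(D ⊔ LinearMap.ker k) =
        Module.finrank 𝕜 V := fun k hk => by
    have := ((D.map k).mkQ ∘ₗ k).finrank_range_add_finrank_ker
    rwa [LinearMap.range_comp, LinearMap.range_eq_top.2 hk, Submodule.map_top,
      Submodule.range_mkQ, finrank_top,
      LinearMap.ker_comp, Submodule.ker_mkQ, Submodule.comap_map_eq] at this
  have hf' := hdim f hf
  have hg' := hdim g hg
  rw [sup_eq_left.2 h, hD] at hf'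
  have : D = D ⊔ LinearMap.ker g :=
    Submodule.eq_of_le_of_finrank_eq le_sup_left (by omega)
  rw [this]
  exact le_sup_right

end LinearAlgebra

/-! ### Defining pairs as central extensions with kernel in the derived algebra. -/

section Covers

variable {𝕜 : Type*} [Field 𝕜] {E L : Type*}
  [NonUnitalNonAssocRing E] [Module 𝕜 E] [IsScalarTower 𝕜 E E] [SMulCommClass 𝕜 E E]
  [NonUnitalNonAssocRing L] [Module 𝕜 L]

theorem IsDefiningPair.exists_hom {M : AlgIdeal 𝕜 E} (h : IsDefiningPair 𝕜 L E M) :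
    ∃ ψ : E →ₙₐ[𝕜] L, IsCentralExtension ψ ∧ (ker ψ).toSubmodule ≤ derived 𝕜 E := by
  obtain ⟨⟨e, he⟩, hM⟩ := h
  have hker : (ker (e.comp M.projHom)).toSubmodule ≤ M.toSubmodule := fun x hx => by
    have hx' : e (M.proj x) = 0 := hx
    rw [← map_zero e] at hx'
    exact M.proj_eq_zero_iff.1 (he.1 hx')
  exact ⟨e.comp M.projHom, ⟨he.2.comp M.proj_surjective, hker.trans (hM.trans inf_le_left)⟩,
    hker.trans (hM.trans inf_le_right)⟩

theorem IsCentralExtension.isDefiningPair {ψ : E →ₙₐ[𝕜] L} (hψ : IsCentralExtension ψ)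
    (h : (ker ψ).toSubmodule ≤ derived 𝕜 E) : IsDefiningPair 𝕜 L E (ker ψ) := by
  refine ⟨⟨(ker ψ).lift ψ le_rfl, ?_, fun x => ?_⟩, le_inf hψ.2 h⟩
  · rw [injective_iff_map_eq_zero]
    intro x hx
    obtain ⟨x, rfl⟩ := AlgIdeal.proj_surjective _ x
    exact (AlgIdeal.proj_eq_zero_iff _).2 hx
  · obtain ⟨y, rfl⟩ := hψ.1 x
    exact ⟨(ker ψ).proj y, rfl⟩

/-- A central extension of a Leibniz algebra has a quotient that is a stem extension by the
part of the kernel inside the derived algebra. -/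
theorem IsCentralExtension.exists_stem_quotient
    {ρ : E →ₙₐ[𝕜] L} (hρ : IsCentralExtension ρ) :
    ∃ (S : AlgIdeal 𝕜 E) (ψ : S.Quotient →ₙₐ[𝕜] L), (∀ x, ψ (S.proj x) = ρ x) ∧
      IsCentralExtension ψ ∧ (ker ψ).toSubmodule ≤ derived 𝕜 S.Quotient ∧
      Disjoint ((ker ρ).toSubmodule ⊓ derived 𝕜 E) S.toSubmodule := by
  -- By the modular law `ker ρ ⊓ Q` complements `ker ρ ⊓ E'` inside `ker ρ`. It is central, hence an
  -- ideal, and dividing by it leaves only the part of the kernel inside `E'`.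
  obtain ⟨Q, hQ⟩ := Submodule.exists_isCompl ((ker ρ).toSubmodule ⊓ derived 𝕜 E)
  have hSR : (ker ρ).toSubmodule ⊓ Q ≤ (ker ρ).toSubmodule := inf_le_left
  let S : AlgIdeal 𝕜 E := AlgIdeal.ofLeCenter _ (hSR.trans hρ.2)
  let ψ : S.Quotient →ₙₐ[𝕜] L := S.lift ρ hSR
  have hψ : ∀ x, ψ (S.proj x) = ρ x := fun _ => rfl
  refine ⟨S, ψ, hψ, ⟨fun x => ?_, fun x hx a => ?_⟩, fun x hx => ?_,
    hQ.disjoint.mono_right inf_le_right⟩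
  · obtain ⟨y, rfl⟩ := hρ.1 x
    exact ⟨S.proj y, rfl⟩
  · obtain ⟨x, rfl⟩ := S.proj_surjective x
    obtain ⟨a, rfl⟩ := S.proj_surjective a
    have hx' : ρ x = 0 := hx
    rw [← S.proj_mul, ← S.proj_mul, (hρ.mul_eq_zero hx' a).1, (hρ.mul_eq_zero hx' a).2, map_zero]
    exact ⟨rfl, rfl⟩
  · obtain ⟨x, rfl⟩ := S.proj_surjective x
    have hx' : x ∈ (ker ρ).toSubmodule := hx
    obtain ⟨t, ht, q, hq, rfl⟩ := Submodule.mem_sup.1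
      (hQ.sup_eq_top ▸ Submodule.mem_top : x ∈ ((ker ρ).toSubmodule ⊓ derived 𝕜 E) ⊔ Q)
    have hqR : q ∈ (ker ρ).toSubmodule := by
      have := sub_mem hx' ht.1
      rwa [add_sub_cancel_left] at this
    have hq0 : S.proj q = 0 := S.proj_eq_zero_iff.2 ⟨hqR, hq⟩
    rw [map_add, hq0, add_zero, ← map_derived (f := S.projHom) S.proj_surjective]
    exact ⟨t, ht.2, rfl⟩

end Covers

/-! ### Stem extensions of finite-dimensional algebras. -/

/-- In a stem extension of a finite-dimensional algebra, the kernel lies in the derived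
algebra. -/
theorem IsStemExtension.ker_le_derived {𝕜 : Type v} [Field 𝕜] {L : Type u}
    [NonUnitalNonAssocRing L] [Module 𝕜 L]
    [FiniteDimensional 𝕜 L] {E : Type (max u v)} [NonUnitalNonAssocRing E] [Module 𝕜 E]
    [IsScalarTower 𝕜 E E] [SMulCommClass 𝕜 E E] {φ : E →ₙₐ[𝕜] L} (h : IsStemExtension φ) :
    (ker φ).toSubmodule ≤ derived 𝕜 E := by
  obtain ⟨hφ, ⟨M, hM⟩, -⟩ := h
  -- The map `ψ` from the defining pair may differ from `φ`, but both carry `E'` onto `L'`, so the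
  -- dimension count transfers the inclusion.
  obtain ⟨ψ, hψ, hψ'⟩ := hM.exists_hom
  have := hψ.finiteDimensional hψ'
  exact ker_le_of_map_eq (f := (ψ : E →ₗ[𝕜] L)) (g := (φ : E →ₗ[𝕜] L)) hψ.1 hφ.1
    (by rw [map_derived hψ.1, map_derived hφ.1]) hψ'

/-- A central extension that dominates a stem extension of a finite-dimensional algebra maps
the part of its kernel inside the derived algebra injectively. -/
theorem IsStemExtension.eq_zero_of_mem_derived {𝕜 : Type v} [Field 𝕜] {L : Type u}
    [NonUnitalNonAssocRing L] [Module 𝕜 L]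
    [FiniteDimensional 𝕜 L] {E P : Type (max u v)} [NonUnitalNonAssocRing E] [Module 𝕜 E]
    [IsScalarTower 𝕜 E E] [SMulCommClass 𝕜 E E] [NonUnitalNonAssocRing P] [Module 𝕜 P]
    [IsScalarTower 𝕜 P P] [SMulCommClass 𝕜 P P] [IsLeibniz P] {φ : E →ₙₐ[𝕜] L}
    (h : IsStemExtension φ) {ρ : P →ₙₐ[𝕜] L} (hρ : IsCentralExtension ρ) {η : P →ₙₐ[𝕜] E}
    (hη : ∀ x, φ (η x) = ρ x) (hηs : Function.Surjective η) {x : P} (hx : x ∈ derived 𝕜 P)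
    (hx0 : η x = 0) : x = 0 := by
  have hE := h.1.finiteDimensional h.ker_le_derived
  obtain ⟨S, ψ, hψ, hψc, hψd, hST⟩ := hρ.exists_stem_quotient
  have hK := hψc.finiteDimensional hψd
  -- The stem quotient is the first member of a defining pair, so maximality of the cover `E`
  -- applies to it.
  have hrank : Module.finrank 𝕜 S.Quotient ≤ Module.finrank 𝕜 E := by
    have := h.2.2 S.Quotient _ (hψc.isDefiningPair hψd)
    rwa [← Module.finrank_eq_rank, ← Module.finrank_eq_rank, Nat.cast_le] at this
  have hker : Module.finrank 𝕜 (LinearMap.ker (ψ : S.Quotient →ₗ[𝕜] L)) ≤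
      Module.finrank 𝕜 (LinearMap.ker (φ : E →ₗ[𝕜] L)) := by
    have h₁ := (ψ : S.Quotient →ₗ[𝕜] L).finrank_range_add_finrank_ker
    have h₂ := (φ : E →ₗ[𝕜] L).finrank_range_add_finrank_ker
    rw [LinearMap.range_eq_top.2 hψc.1] at h₁
    rw [LinearMap.range_eq_top.2 h.1.1] at h₂
    omega
  have := hρ.finiteDimensional_derived
  set T : Submodule 𝕜 P := (ker ρ).toSubmodule ⊓ derived 𝕜 P with hT
  have hTfin : FiniteDimensional 𝕜 T := Submodule.finiteDimensional_of_le inf_le_right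
  have hTker : Module.finrank 𝕜 T ≤
      Module.finrank 𝕜 (LinearMap.ker (ψ : S.Quotient →ₗ[𝕜] L)) := by
    refine LinearMap.finrank_le_finrank_of_injective
      (f := S.proj.restrict (p := T) (q := LinearMap.ker (ψ : S.Quotient →ₗ[𝕜] L))
        fun t ht => (hψ t).trans ht.1) ?_
    rw [injective_iff_map_eq_zero]
    intro t ht
    have ht0 : S.proj t = 0 := congrArg Subtype.val ht
    exact Subtype.ext (Submodule.disjoint_def.1 hST _ t.2 (S.proj_eq_zero_iff.1 ht0))
  -- `T` embeds in `ker ψ`, so `dim T ≤ dim ker φ`. As `η` maps `T` onto `ker φ`, the dimensions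
  -- agree and the map is injective.
  let r : T →ₗ[𝕜] LinearMap.ker (φ : E →ₗ[𝕜] L) :=
    (η : P →ₗ[𝕜] E).restrict fun t ht => (hη t).trans ht.1
  have hr : Function.Surjective r := by
    rintro ⟨y, hy⟩
    have hyd := h.ker_le_derived hy
    rw [← map_derived hηs] at hyd
    obtain ⟨t, ht, rfl⟩ := hyd
    exact ⟨⟨t, (hη t).symm.trans hy, ht⟩, rfl⟩
  have hri : Function.Injective r := by
    refine (LinearMap.injective_iff_surjective_of_finrank_eq_finrank
      (le_antisymm (hTker.trans hker) ?_)).2 hr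
    exact LinearMap.finrank_le_finrank_of_surjective hr
  have hxT : x ∈ T := ⟨mem_ker.2 (by rw [← hη, hx0, map_zero]), hx⟩
  have : (⟨x, hxT⟩ : T) = 0 := hri ((Subtype.ext hx0 : r ⟨x, hxT⟩ = 0).trans (map_zero r).symm)
  exact congrArg Subtype.val this

/-- The range of `η` covers `L` and contains every product in `E`, hence `E'` and with it `ker φ`.
-/
theorem IsStemExtension.surjective_of_comp {𝕜 : Type v} [Field 𝕜] {L : Type u}
    [NonUnitalNonAssocRing L] [Module 𝕜 L]
    [FiniteDimensional 𝕜 L] {E : Type (max u v)} [NonUnitalNonAssocRing E] [Module 𝕜 E]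
    [IsScalarTower 𝕜 E E] [SMulCommClass 𝕜 E E] {P : Type*} [NonUnitalNonAssocRing P]
    [Module 𝕜 P] {φ : E →ₙₐ[𝕜] L} (h : IsStemExtension φ) {ρ : P →ₙₐ[𝕜] L}
    (hρ : Function.Surjective ρ) {η : P →ₙₐ[𝕜] E} (hη : ∀ x, φ (η x) = ρ x) :
    Function.Surjective η := by
  have hd : derived 𝕜 E ≤ LinearMap.range (η : P →ₗ[𝕜] E) := by
    refine Submodule.span_le.2 ?_
    rintro _ ⟨a, b, rfl⟩
    obtain ⟨p, hp⟩ := hρ (φ a)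
    obtain ⟨q, hq⟩ := hρ (φ b)
    rw [h.1.mul_eq_mul (c := η p) (d := η q) (by rw [hη, hp]) (by rw [hη, hq])]
    exact ⟨p * q, map_mul η p q⟩
  intro y
  obtain ⟨p, hp⟩ := hρ (φ y)
  obtain ⟨q, hq⟩ := hd (h.ker_le_derived
    (show y - η p ∈ _ from mem_ker.2 (by rw [map_sub, hη, hp, sub_self])))
  refine ⟨q + p, ?_⟩
  have hq' : η q = y - η p := hq
  rw [map_add, hq', sub_add_cancel]

/-- The center of a stem extension of a finite-dimensional algebra comes from the center of
every central extension that dominates it. -/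
theorem IsStemExtension.image_center_subset {𝕜 : Type v} [Field 𝕜] {L : Type u}
    [NonUnitalNonAssocRing L] [Module 𝕜 L]
    [FiniteDimensional 𝕜 L] {E P : Type (max u v)} [NonUnitalNonAssocRing E] [Module 𝕜 E]
    [IsScalarTower 𝕜 E E] [SMulCommClass 𝕜 E E] [NonUnitalNonAssocRing P] [Module 𝕜 P]
    [IsScalarTower 𝕜 P P] [SMulCommClass 𝕜 P P] [IsLeibniz P] {φ : E →ₙₐ[𝕜] L}
    (h : IsStemExtension φ) {ρ : P →ₙₐ[𝕜] L} (hρ : IsCentralExtension ρ) {η : P →ₙₐ[𝕜] E}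
    (hη : ∀ x, φ (η x) = ρ x) :
    φ '' (center 𝕜 E : Set E) ⊆ ρ '' (center 𝕜 P : Set P) := by
  have hηs := h.surjective_of_comp hρ.1 hη
  rintro _ ⟨z, hz, rfl⟩
  obtain ⟨p, rfl⟩ := hηs z
  refine ⟨p, fun a => ⟨?_, ?_⟩, (hη p).symm⟩
  · exact h.eq_zero_of_mem_derived hρ hη hηs (mul_mem_derived p a)
      ((map_mul η p a).trans (hz (η a)).1)
  · exact h.eq_zero_of_mem_derived hρ hη hηs (mul_mem_derived a p)
      ((map_mul η a p).trans (hz (η a)).2)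

/-! ### Computation of `Z*(L)` and the main theorem. -/

/-- Every Leibniz algebra has a free presentation in the universe over which `zStar` ranges. -/
theorem exists_free_presentation (𝕜 : Type v) [Field 𝕜] (L : Type u) [NonUnitalNonAssocRing L]
    [Module 𝕜 L] [IsScalarTower 𝕜 L L] [SMulCommClass 𝕜 L L] [IsLeibniz L] :
    ∃ π : FreeLeibniz 𝕜 (ULift.{v} L) →ₙₐ[𝕜] L, Function.Surjective π :=
  ⟨FreeLeibniz.lift ULift.down, fun x => ⟨FreeLeibniz.of ⟨x⟩, FreeLeibniz.lift_of _ _⟩⟩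

theorem zStar_eq {𝕜 : Type v} [Field 𝕜] {L : Type u} [NonUnitalNonAssocRing L]
    [Module 𝕜 L] [IsScalarTower 𝕜 L L] [SMulCommClass 𝕜 L L] [IsLeibniz L]
    {F : Type w} [NonUnitalNonAssocRing F] [Module 𝕜 F] [IsScalarTower 𝕜 F F]
    [SMulCommClass 𝕜 F F] (hF : IsFreeLeibniz 𝕜 F) {π : F →ₙₐ[𝕜] L}
    (hπ : Function.Surjective π) :
    zStar 𝕜 L = barMap π '' (center 𝕜 (Bar π) : Set (Bar π)) := by
  apply Set.Subset.antisymm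
  · intro x hx
    have := hF.isLeibniz
    -- `Bar π` may live outside the universe of `zStar`, so membership is tested on `Bar π₀` and
    -- then carried to `Bar π` by weak universality.
    obtain ⟨π₀, hπ₀⟩ := exists_free_presentation 𝕜 L
    exact (FreeLeibniz.isFreeLeibniz 𝕜 L).image_center_subset (isCentralExtension_barMap hπ) hπ₀
      (hx _ (barMap π₀) (isCentralExtension_barMap hπ₀))
  · intro x hx E _ _ _ _ _ φ hφ
    exact hF.image_center_subset hφ hπ hx

end Leibniz

theorem mainTheorem5 {𝕜 : Type v} [Field 𝕜]
    {L : Type u} [NonUnitalNonAssocRing L] [Module 𝕜 L] [IsScalarTower 𝕜 L L]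
    [SMulCommClass 𝕜 L L] [IsLeibniz L]
    {F : Type w} [NonUnitalNonAssocRing F] [Module 𝕜 F] [IsScalarTower 𝕜 F F]
    [SMulCommClass 𝕜 F F] (hF : Leibniz.IsFreeLeibniz 𝕜 F)
    (π : F →ₙₐ[𝕜] L) (hπ : Function.Surjective π) :
    Leibniz.zStar 𝕜 L =
        Leibniz.barMap π '' (Leibniz.center 𝕜 (Leibniz.Bar π) : Set (Leibniz.Bar π)) ∧
      (FiniteDimensional 𝕜 L →
        ∀ (E : Type (max u v)) [NonUnitalNonAssocRing E] [Module 𝕜 E] [IsScalarTower 𝕜 E E]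
          [SMulCommClass 𝕜 E E] [IsLeibniz E] (φ : E →ₙₐ[𝕜] L),
          Leibniz.IsStemExtension φ →
            Leibniz.zStar 𝕜 L = φ '' (Leibniz.center 𝕜 E : Set E)) := by
  refine ⟨Leibniz.zStar_eq hF hπ, fun _ E _ _ _ _ _ φ hφ => Set.Subset.antisymm
    (fun x hx => hx E φ hφ.1) ?_⟩
  obtain ⟨π₀, hπ₀⟩ := Leibniz.exists_free_presentation 𝕜 L
  have hF₀ := Leibniz.FreeLeibniz.isFreeLeibniz 𝕜 L
  obtain ⟨η, hη⟩ := hF₀.exists_bar_lift hφ.1 π₀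
  rw [Leibniz.zStar_eq hF₀ hπ₀]
  exact hφ.image_center_subset (Leibniz.isCentralExtension_barMap hπ₀) hη
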